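/- Let $(\Omega,\mathcal F,\mathbb P)$ be an atomless probability space (every $A\in\mathcal F$ with $\mathbb P[A]>0$ contains some $B\in\mathcal F$ with $0<\mathbb P[B]<\mathbb P[A]$), and let $\Psi:[0,\infty)\to[0,\infty)$ be a finite Young function, i.e. a continuous, nondecreasing, convex function with $\Psi(0)=0$ and $\lim_{x\to\infty}\Psi(x)=\infty$. Let $$H^\Psi=\{X\in L^0(\Omega,\mathcal F,\mathbb P):\ \mathbb E[\Psi(c|X|)]<\infty\text{ for all }c>0\}$$ be the Orlicz heart. For $k=1,2,\dots$ put $\psi_k(x)=\Psi(k|x|)$, $x\in\mathbb R$, and let $\mathcal M_1^{(\psi_k)}$ be the set of all Borel probability measures $\mu$ on $\mathbb R$ with $\int\psi_k\,d\mu<\infty$ for every $k\ge 1$. The $(\psi_k)$-weak topology on $\mathcal M_1^{(\psi_k)}$ is the coarsest topology for which all maps $\mu\mapsto\int f\,d\mu$ are continuous, where $f:\mathbb R\to\mathbb R$ runs through the continuous functions with $\sup_{x\in\mathbb R}|f(x)/(1+\psi_k(x))|<\infty$ for some $k\ge 1$. Let $\rho:H^\Psi\to\mathbb R$ be a law-invariant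 convex risk measure (not necessarily monetary), i.e. a map such that * $\rho(X)\ge\rho(Y)$ for all $X,Y\in H^\Psi$ with $X\le Y$ $\mathbb P$-a.s.; * $\rho(\lambda X+(1-\lambda)Y)\le\lambda\rho(X)+(1-\lambda)\rho(Y)$ for all $X,Y\in H^\Psi$ and $\lambda\in[0,1]$; * $\rho(X)=\rho(Y)$ for all $X,Y\in H^\Psi$ with $\mathbb P\circ X^{-1}=\mathbb P\circ Y^{-1}$. Then the set $\mathcal M(H^\Psi)=\{\mathbb P\circ X^{-1}:X\in H^\Psi\}$ equals $\mathcal M_1^{(\psi_k)}$; there is exactly one map $\mathcal R_\rho:\mathcal M_1^{(\psi_k)}\to\mathbb R$ (the risk functional associated with $\rho$) with $\rho(X)=\mathcal R_\rho(\mathbb P\circ X^{-1})$ for all $X\in H^\Psi$; and $\mathcal R_\rho$ is continuous with respect to the $(\psi_k)$-weak topology. -/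

import Mathlib

open MeasureTheory Set
open scoped NNReal ENNReal

noncomputable section

namespace RiskFunctional

section GaugeWeak

variable {E ι : Type*} [TopologicalSpace E] [MeasurableSpace E]

/-- The space `C_φ` of all continuous `f : E → ℝ` with `sup_x |f x / (1 + φ x)| < ∞`. -/
def gaugeBounded (φ : E → ℝ≥0) : Set (E → ℝ) :=
  {f | Continuous f ∧ BddAbove (range fun x => |f x / (1 + (φ x : ℝ))|)}

/-- The set of all Borel probability measures `μ` on `E` with `∫ ψ k dμ < ∞` for every index `k`,
as a type of its own (it does not inherit the weak topology). -/
structure GaugeMeasure (ψ : ι → E → ℝ≥0) where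
  /-- The underlying probability measure. -/
  toProb : ProbabilityMeasure E
  lintegral_lt_top : ∀ k, ∫⁻ x, (ψ k x : ℝ≥0∞) ∂(toProb : Measure E) < ∞

/-- The `(ψ k)`-weak topology: the coarsest topology for which all maps `μ ↦ ∫ f dμ`, with
`f ∈ C_{ψ k}` for some `k`, are continuous. -/
instance gaugeWeakTopology (ψ : ι → E → ℝ≥0) : TopologicalSpace (GaugeMeasure ψ) :=
  ⨅ (k : ι) (f : gaugeBounded (ψ k)),
    TopologicalSpace.induced
      (fun μ : GaugeMeasure ψ => ∫ x, (f : E → ℝ) x ∂(μ.toProb : Measure E)) inferInstance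

end GaugeWeak

/-- A finite Young function: continuous, nondecreasing, convex `Ψ : ℝ₊ → ℝ₊` with `Ψ 0 = 0` and
`Ψ x → ∞` as `x → ∞`. -/
structure YoungFunction where
  /-- The underlying function. -/
  toFun : ℝ≥0 → ℝ≥0
  continuous' : Continuous toFun
  monotone' : Monotone toFun
  convex' : ConvexOn ℝ≥0 univ toFun
  map_zero' : toFun 0 = 0
  tendsto' : Filter.Tendsto toFun Filter.atTop Filter.atTop

instance : CoeFun YoungFunction (fun _ => ℝ≥0 → ℝ≥0) := ⟨YoungFunction.toFun⟩

/-- The gauge functions `ψ_k = Ψ(k |·|)` on `ℝ`, `k = 1, 2, …`. -/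
def orliczGauge (Ψ : YoungFunction) (k : ℕ+) (x : ℝ) : ℝ≥0 :=
  Ψ (((k : ℕ) : ℝ≥0) * ‖x‖₊)

/-- Every set of positive measure has a measurable subset of strictly smaller positive measure.
(This is stronger than all singletons being null sets.) -/
def Atomless {Ω : Type*} [MeasurableSpace Ω] (P : Measure Ω) : Prop :=
  ∀ A, MeasurableSet A → 0 < P A → ∃ B ⊆ A, MeasurableSet B ∧ 0 < P B ∧ P B < P A

section Orlicz

variable {Ω : Type*} [MeasurableSpace Ω]

theorem YoungFunction.add_le (Ψ : YoungFunction) (a b : ℝ≥0) :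
    Ψ (a + b) ≤ Ψ (2 * a) + Ψ (2 * b) := by
  rcases le_total a b with h | h
  · exact (Ψ.monotone' (by rw [two_mul]; gcongr)).trans le_add_self
  · exact (Ψ.monotone' (by rw [two_mul]; gcongr)).trans le_self_add

/-- The Orlicz heart `H^Ψ` of all (classes of) random variables `X` with `E[Ψ(c|X|)] < ∞` for every
`c > 0`, a linear subspace of `L⁰`. -/
def orliczHeart (P : Measure Ω) (Ψ : YoungFunction) : Submodule ℝ (Ω →ₘ[P] ℝ) where
  carrier := {X | ∀ c : ℝ≥0, 0 < c → ∫⁻ ω, (Ψ (c * ‖X ω‖₊) : ℝ≥0∞) ∂P < ∞}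
  zero_mem' := by
    intro c _
    have h : ∀ᵐ ω ∂P, (Ψ (c * ‖(0 : Ω →ₘ[P] ℝ) ω‖₊) : ℝ≥0∞) = 0 := by
      filter_upwards [AEEqFun.coeFn_zero (α := Ω) (β := ℝ) (μ := P)] with ω hω
      simp [hω, Ψ.map_zero']
    simp [lintegral_congr_ae h]
  add_mem' := by
    intro X Y hX hY c hc
    have hc2 : 0 < 2 * c := by positivity
    have hm : Measurable fun ω => (Ψ (2 * c * ‖X ω‖₊) : ℝ≥0∞) :=
      (Ψ.continuous'.measurable.comp
        (measurable_const.mul X.measurable.nnnorm)).coe_nnreal_ennreal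
    have h : ∀ᵐ ω ∂P, (Ψ (c * ‖(X + Y) ω‖₊) : ℝ≥0∞) ≤
        Ψ (2 * c * ‖X ω‖₊) + Ψ (2 * c * ‖Y ω‖₊) := by
      filter_upwards [AEEqFun.coeFn_add X Y] with ω hω
      rw [hω, Pi.add_apply]
      norm_cast
      calc Ψ (c * ‖X ω + Y ω‖₊) ≤ Ψ (c * ‖X ω‖₊ + c * ‖Y ω‖₊) :=
            Ψ.monotone' (by rw [← mul_add]; gcongr; exact nnnorm_add_le _ _)
        _ ≤ _ := by simpa [mul_assoc] using Ψ.add_le (c * ‖X ω‖₊) (c * ‖Y ω‖₊)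
    refine (lintegral_mono_ae h).trans_lt ?_
    rw [lintegral_add_left hm]
    exact ENNReal.add_lt_top.2 ⟨hX _ hc2, hY _ hc2⟩
  smul_mem' := by
    intro a X hX c hc
    refine lt_of_le_of_lt (lintegral_mono_ae ?_) (hX (c * (‖a‖₊ + 1)) (by positivity))
    filter_upwards [AEEqFun.coeFn_smul a X] with ω hω
    rw [hω, Pi.smul_apply, nnnorm_smul, ← mul_assoc]
    have : ‖a‖₊ ≤ ‖a‖₊ + 1 := le_self_add
    exact_mod_cast Ψ.monotone' (by gcongr)

/-- The law `P ∘ X⁻¹` of a random variable. -/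
def law (P : Measure Ω) [IsProbabilityMeasure P] (X : Ω →ₘ[P] ℝ) : ProbabilityMeasure ℝ :=
  ⟨P.map X, Measure.isProbabilityMeasure_map X.aemeasurable⟩

/-- The law of an element of `H^Ψ`, as an element of `M_1^{(ψ_k)}`. -/
def heartLaw (P : Measure Ω) [IsProbabilityMeasure P] (Ψ : YoungFunction)
    (X : orliczHeart P Ψ) : GaugeMeasure (orliczGauge Ψ) where
  toProb := law P X
  lintegral_lt_top := by
    intro k
    have hm : Measurable fun x : ℝ => (orliczGauge Ψ k x : ℝ≥0∞) :=
      (Ψ.continuous'.measurable.comp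
        (measurable_const.mul measurable_nnnorm)).coe_nnreal_ennreal
    change ∫⁻ x, (orliczGauge Ψ k x : ℝ≥0∞) ∂(P.map (X : Ω →ₘ[P] ℝ)) < ∞
    rw [lintegral_map hm (X : Ω →ₘ[P] ℝ).measurable]
    exact X.2 _ (by exact_mod_cast k.pos)

/-- A law-invariant convex risk measure `ρ : H^Ψ → ℝ`. The order on `L⁰` is the almost sure one. -/
structure IsLawInvariantConvexRiskMeasure (P : Measure Ω) [IsProbabilityMeasure P]
    (Ψ : YoungFunction) (ρ : orliczHeart P Ψ → ℝ) : Prop where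
  monotonicity : ∀ X Y : orliczHeart P Ψ,
    (∀ᵐ ω ∂P, (X : Ω →ₘ[P] ℝ) ω ≤ (Y : Ω →ₘ[P] ℝ) ω) → ρ Y ≤ ρ X
  convexity : ∀ (X Y : orliczHeart P Ψ) (l : ℝ), 0 ≤ l → l ≤ 1 →
    ρ (l • X + (1 - l) • Y) ≤ l * ρ X + (1 - l) * ρ Y
  lawInvariance : ∀ X Y : orliczHeart P Ψ, law P X = law P Y → ρ X = ρ Y

/-- `R : M_1^{(ψ_k)} → ℝ` is the risk functional of `ρ`: `ρ(X) = R(P ∘ X⁻¹)` for all `X ∈ H^Ψ`. -/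
def IsRiskFunctional (P : Measure Ω) [IsProbabilityMeasure P] (Ψ : YoungFunction)
    (ρ : orliczHeart P Ψ → ℝ) (R : GaugeMeasure (orliczGauge Ψ) → ℝ) : Prop :=
  ∀ X : orliczHeart P Ψ, ρ X = R (heartLaw P Ψ X)

end Orlicz

end RiskFunctional

end

/-!
An atomless probability space carries a uniform variable `U`: along a maximal chain of measurable
sets the measure takes every value in `[0, 1]`, since the set of values is closed and atomlessness
leaves it no gaps. Hence every measure `μ` in question is the law of the element `q_μ(U)` of the
Orlicz heart, where `q_μ` is the quantile function, and uniqueness of the risk functional follows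
from this surjectivity.

For continuity it suffices to consider sequences `μₙ → μ` along which all gauge moments converge
too. Then `q_{μₙ}(U) → q_μ(U)` almost surely, and generalized dominated convergence upgrades this to
`E[Ψ(k|q_{μₙ}(U) - q_μ(U)|)] → 0` for all `k`. Along a subsequence these differences become
`|Xⱼ - X| ≤ W / j` for a single element `W` of the Orlicz heart, and a convex function bounded above
by its value at `X - W` on the order interval `[X - W, X + W]`, as an antitone one is, converges
along such a sequence.
-/

namespace RiskFunctional

open ProbabilityTheory Filter Topology

section MeasureChain

variable {Ω : Type*} [MeasurableSpace Ω] {P : Measure Ω}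

/-- The strict order on measurable sets given by inclusion together with a strict increase of the
measure. Strictness makes the members of a chain comparable by their measures alone. -/
def MeasureLT (P : Measure Ω) (A B : {s : Set Ω // MeasurableSet s}) : Prop :=
  (A : Set Ω) ⊆ B ∧ P A < P B

/-- The set of measures of the members of a family `M` of measurable sets. -/
def measureValues (P : Measure Ω) (M : Set {s : Set Ω // MeasurableSet s}) : Set ℝ≥0∞ :=
  (fun A : {s : Set Ω // MeasurableSet s} => P A) '' M

variable {M : Set {s : Set Ω // MeasurableSet s}}

theorem subset_of_measure_le_of_isChain (hM : IsChain (MeasureLT P) M)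
    {A B : {s : Set Ω // MeasurableSet s}} (hA : A ∈ M) (hB : B ∈ M) (hAB : P A ≤ P B) :
    (A : Set Ω) ⊆ B := by
  rcases eq_or_ne A B with rfl | hne
  · exact Subset.rfl
  · exact (hM hA hB hne).elim (fun h => h.1) fun h => absurd h.2 hAB.not_gt

theorem measure_mem_measureValues_of_isMaxChain (hM : IsMaxChain (MeasureLT P) M)
    {D : Set Ω} (hD : MeasurableSet D) (hlow : ∀ A ∈ M, P A < P D → (A : Set Ω) ⊆ D)
    (hhigh : ∀ A ∈ M, P D < P A → D ⊆ A) : P D ∈ measureValues P M := by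
  by_contra hnot
  have hcomparable : ∀ A ∈ M, MeasureLT P ⟨D, hD⟩ A ∨ MeasureLT P A ⟨D, hD⟩ := fun A hA => by
    rcases lt_trichotomy (P A) (P D) with h | h | h
    · exact .inr ⟨hlow A hA h, h⟩
    · exact absurd ⟨A, hA, h⟩ hnot
    · exact .inl ⟨hhigh A hA h, h⟩
  have hinsert : M = insert ⟨D, hD⟩ M :=
    hM.2 (hM.1.insert fun A hA _ => hcomparable A hA) (subset_insert _ _)
  exact hnot ⟨⟨D, hD⟩, hinsert ▸ mem_insert _ _, rfl⟩

theorem measure_limsup_of_total [IsFiniteMeasure P] {A : ℕ → Set Ω}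
    (hA : ∀ n, MeasurableSet (A n)) (htotal : ∀ m n, A m ⊆ A n ∨ A n ⊆ A m) :
    P (limsup A atTop) = limsup (fun n => P (A n)) atTop := by
  rw [limsup_eq_iInf_iSup_of_nat', limsup_eq_iInf_iSup_of_nat', iInf_eq_iInter]
  simp only [iSup_eq_iUnion]
  have hanti : Antitone fun n => ⋃ i, A (i + n) := fun m n hmn =>
    iUnion_subset fun i => subset_iUnion_of_subset (i + n - m) (by
      rw [Nat.sub_add_cancel (hmn.trans (Nat.le_add_left n i))])
  rw [hanti.measure_iInter (fun n => (MeasurableSet.iUnion fun i => hA _).nullMeasurableSet)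
    ⟨0, measure_ne_top _ _⟩]
  refine iInf_congr fun n => Directed.measure_iUnion fun i j => ?_
  exact (htotal (i + n) (j + n)).elim (fun h => ⟨j, h, Subset.rfl⟩) fun h => ⟨i, Subset.rfl, h⟩

theorem isClosed_measureValues_of_isMaxChain [IsFiniteMeasure P]
    (hM : IsMaxChain (MeasureLT P) M) : IsClosed (measureValues P M) := by
  refine isClosed_of_closure_subset fun v hv => ?_
  obtain ⟨u, hu, hlim⟩ := mem_closure_iff_seq_limit.1 hv
  choose A hAM hAu using hu
  obtain rfl : u = fun n => P (A n) := funext fun n => (hAu n).symm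
  have hsub {B C} (hB : B ∈ M) (hC : C ∈ M) (h : P B ≤ P C) : (B : Set Ω) ⊆ C :=
    subset_of_measure_le_of_isChain hM.1 hB hC h
  have hmeas : P (limsup (fun n => (A n : Set Ω)) atTop) = v := by
    rw [measure_limsup_of_total (fun n => (A n).2) fun m n =>
      (le_total (P (A m)) (P (A n))).imp (hsub (hAM m) (hAM n)) (hsub (hAM n) (hAM m))]
    exact hlim.limsup_eq
  rw [← hmeas] at hlim ⊢
  refine measure_mem_measureValues_of_isMaxChain hM (.measurableSet_limsup fun n => (A n).2)
    (fun B hB hlt ω hω => ?_) fun B hB hlt ω hω => ?_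
  · rw [mem_limsup_iff_frequently_mem]
    exact ((hlim.eventually_const_lt hlt).mono fun n hn =>
      hsub hB (hAM n) hn.le hω).frequently
  · rw [mem_limsup_iff_frequently_mem] at hω
    obtain ⟨n, hωn, hn⟩ := (hω.and_eventually (hlim.eventually_lt_const hlt)).exists
    exact hsub (hAM n) hB hn.le hωn

theorem exists_measure_mem_Ioo_of_isMaxChain [IsFiniteMeasure P] (hP : Atomless P)
    (hM : IsMaxChain (MeasureLT P) M) {A B : {s : Set Ω // MeasurableSet s}} (hA : A ∈ M)
    (hB : B ∈ M) (hAB : P A < P B) : ∃ C ∈ M, P C ∈ Ioo (P A) (P B) := by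
  have hsub {C D} (hC : C ∈ M) (hD : D ∈ M) (h : P C ≤ P D) : (C : Set Ω) ⊆ D :=
    subset_of_measure_le_of_isChain hM.1 hC hD h
  have hdiff : P A + P (B \ A : Set Ω) = P B := by
    rw [measure_add_sdiff A.2.nullMeasurableSet, union_eq_self_of_subset_left (hsub hA hB hAB.le)]
  have hpos : 0 < P (B \ A : Set Ω) := by
    refine pos_iff_ne_zero.2 fun h => hAB.ne ?_
    rw [← hdiff, h, add_zero]
  obtain ⟨D, hDsub, hDm, hD0, hDlt⟩ := hP _ (B.2.diff A.2) hpos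
  have hunion : P (A ∪ D) = P A + P D :=
    measure_union (disjoint_sdiff_right.mono_right hDsub) hDm
  have hmem : P (A ∪ D) ∈ Ioo (P A) (P B) := by
    rw [hunion, ← hdiff]
    exact ⟨ENNReal.lt_add_right (measure_ne_top _ _) hD0.ne',
      ENNReal.add_lt_add_left (measure_ne_top _ _) hDlt⟩
  by_contra! hgap
  obtain ⟨C, hC, hPC : P C = P (A ∪ D)⟩ := measure_mem_measureValues_of_isMaxChain hM
    (A.2.union hDm)
    (fun C hC hlt => subset_union_of_subset_left (hsub hC hA (not_lt.1 fun h =>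
      hgap C hC ⟨h, hlt.trans hmem.2⟩)) D)
    (fun C hC hlt => (union_subset (hsub hA hB hAB.le) (hDsub.trans sdiff_subset)).trans
      (hsub hB hC (not_lt.1 fun h => hgap C hC ⟨hmem.1.trans hlt, h⟩)))
  exact hgap C hC (hPC ▸ hmem)

theorem measureValues_eq_Iic_of_isMaxChain [IsFiniteMeasure P] (hP : Atomless P)
    (hM : IsMaxChain (MeasureLT P) M) : measureValues P M = Iic (P univ) := by
  refine Subset.antisymm (image_subset_iff.2 fun A _ => measure_mono (subset_univ _))
    fun t ht => ?_
  by_contra hnot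
  have hzero : 0 ∈ measureValues P M := by
    rw [← measure_empty (μ := P)]
    exact measure_mem_measureValues_of_isMaxChain hM .empty (fun A _ h => by simp at h)
      fun A _ _ => empty_subset _
  have huniv : P univ ∈ measureValues P M :=
    measure_mem_measureValues_of_isMaxChain hM .univ (fun A _ _ => subset_univ _)
      fun A _ h => absurd (measure_mono (subset_univ _)) h.not_ge
  have hclosed := isClosed_measureValues_of_isMaxChain hM
  obtain ⟨_, ⟨⟨A, hA, rfl⟩, hAt⟩, hAmax⟩ :=
    (hclosed.inter isClosed_Iic).isCompact.exists_isGreatest ⟨0, hzero, zero_le (a := t)⟩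
  obtain ⟨_, ⟨⟨B, hB, rfl⟩, hBt⟩, hBmin⟩ :=
    (hclosed.inter isClosed_Ici).isCompact.exists_isLeast ⟨P univ, huniv, ht⟩
  have hAt' : P A < t := lt_of_le_of_ne hAt fun h => hnot ⟨A, hA, h⟩
  have hBt' : t < P B := lt_of_le_of_ne hBt fun h => hnot ⟨B, hB, h.symm⟩
  obtain ⟨C, hC, hAC, hCB⟩ := exists_measure_mem_Ioo_of_isMaxChain hP hM hA hB (hAt'.trans hBt')
  rcases le_total (P C) t with h | h
  · exact hAC.not_ge (hAmax ⟨⟨C, hC, rfl⟩, h⟩)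
  · exact hCB.not_ge (hBmin ⟨⟨C, hC, rfl⟩, h⟩)

theorem Atomless.exists_monotone_measure_eq_min [IsFiniteMeasure P] (hP : Atomless P) :
    ∃ E : ℝ≥0∞ → Set Ω, Monotone E ∧ ∀ t, MeasurableSet (E t) ∧ P (E t) = min t (P univ) := by
  have hM : IsMaxChain (MeasureLT P) (maxChain (MeasureLT P)) := maxChain_spec
  have hvalue (t : ℝ≥0∞) : min t (P univ) ∈ measureValues P (maxChain (MeasureLT P)) := by
    rw [measureValues_eq_Iic_of_isMaxChain hP hM]
    exact mem_Iic.2 (min_le_right _ _)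
  choose E hE hPE using hvalue
  refine ⟨fun t => E t, fun s t hst => ?_, fun t => ⟨(E t).2, hPE t⟩⟩
  refine subset_of_measure_le_of_isChain hM.1 (hE s) (hE t) ?_
  exact (hPE s).trans_le ((min_le_min_right _ hst).trans (hPE t).ge)

end MeasureChain

section Uniform

variable {Ω : Type*} [MeasurableSpace Ω] {P : Measure Ω}

theorem Atomless.exists_measurable_measure_le_eq_min [IsFiniteMeasure P] (hP : Atomless P) :
    ∃ U : Ω → ℝ≥0∞, Measurable U ∧ ∀ x, P {ω | U ω ≤ x} = min x (P univ) := by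
  obtain ⟨E, hmono, hE⟩ := hP.exists_monotone_measure_eq_min
  let U (ω : Ω) : ℝ≥0∞ := sInf {t : ℝ≥0∞ | ω ∈ E t}
  have hU {ω : Ω} {x : ℝ≥0∞} : U ω < x ↔ ∃ t < x, ω ∈ E t :=
    sInf_lt_iff.trans (exists_congr fun t => and_comm)
  refine ⟨U, measurable_of_Iio fun x => ?_, fun x => le_antisymm ?_ ?_⟩
  · obtain ⟨S, hS, hdense⟩ := TopologicalSpace.exists_countable_dense ℝ≥0∞
    have hunion : U ⁻¹' Iio x = ⋃ s ∈ S ∩ Iio x, E s := by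
      ext ω
      simp only [mem_preimage, mem_Iio, hU, mem_iUnion, mem_inter_iff, exists_prop]
      constructor
      · rintro ⟨t, htx, ht⟩
        obtain ⟨s, hs, hts, hsx⟩ := hdense.exists_between htx
        exact ⟨s, ⟨hs, hsx⟩, hmono hts.le ht⟩
      · rintro ⟨s, ⟨-, hsx⟩, hs⟩
        exact ⟨s, hsx, hs⟩
    rw [hunion]
    exact .biUnion (hS.mono inter_subset_left) fun s _ => (hE s).1
  · refine le_min (le_of_forall_gt_imp_ge_of_dense fun y hxy => ?_) (measure_mono (subset_univ _))
    calc P {ω | U ω ≤ x} ≤ P (E y) := measure_mono fun ω (hω : U ω ≤ x) => by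
          obtain ⟨t, hty, ht⟩ := hU.1 (hω.trans_lt hxy)
          exact hmono hty.le ht
      _ ≤ y := (hE y).2.trans_le (min_le_left _ _)
  · rw [← (hE x).2]
    exact measure_mono fun ω hω => sInf_le (show x ∈ {t | ω ∈ E t} from hω)

theorem Atomless.exists_hasLaw_uniform [IsProbabilityMeasure P] (hP : Atomless P) :
    ∃ U : Ω → ℝ, HasLaw U (volume.restrict (Ioo 0 1)) P := by
  obtain ⟨U, hU, hUle⟩ := hP.exists_measurable_measure_le_eq_min
  have hU_le_one : ∀ᵐ ω ∂P, U ω ≤ 1 :=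
    (mem_ae_iff_prob_eq_one (hU measurableSet_Iic)).2 ((hUle 1).trans (by simp))
  refine ⟨fun ω => (U ω).toReal, hU.ennreal_toReal.aemeasurable, ?_⟩
  refine Measure.ext_of_Iic _ _ fun x => ?_
  rw [Measure.map_apply hU.ennreal_toReal measurableSet_Iic, restrict_Ioo_eq_restrict_Ioc,
    Measure.restrict_apply measurableSet_Iic, inter_comm, Ioc_inter_Iic, Real.volume_Ioc, sub_zero]
  rcases lt_or_ge x 0 with hx | hx
  · rw [ENNReal.ofReal_of_nonpos (inf_le_right.trans hx.le),
      show (fun ω => (U ω).toReal) ⁻¹' Iic x = ∅ from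
        eq_empty_of_forall_notMem fun ω hω => hx.not_ge (ENNReal.toReal_nonneg.trans hω),
      measure_empty]
  · calc P ((fun ω => (U ω).toReal) ⁻¹' Iic x) = P {ω | U ω ≤ ENNReal.ofReal x} :=
          measure_congr <| hU_le_one.mono fun ω hω => propext
            (ENNReal.le_ofReal_iff_toReal_le (hω.trans_lt ENNReal.one_lt_top).ne hx).symm
      _ = min (ENNReal.ofReal x) 1 := by rw [hUle, measure_univ]
      _ = ENNReal.ofReal (min 1 x) := by
          rw [min_comm, ENNReal.ofReal_min, ENNReal.ofReal_one]

end Uniform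

section Quantile

/-- The lower quantile function of a probability measure on `ℝ`. It is meaningful on `(0, 1)` only:
outside this interval the infimum may be over an empty or unbounded set. -/
noncomputable def quantile (μ : Measure ℝ) (u : ℝ) : ℝ := sInf {x | u ≤ cdf μ x}

theorem quantile_le_iff (μ : Measure ℝ) {u : ℝ} (hu : u ∈ Ioo (0 : ℝ) 1) (x : ℝ) :
    quantile μ u ≤ x ↔ u ≤ cdf μ x := by
  have hbdd : BddBelow {x | u ≤ cdf μ x} := by
    obtain ⟨b, hb⟩ := ((tendsto_cdf_atBot μ).eventually_lt_const hu.1).exists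
    exact ⟨b, fun y (hy : u ≤ cdf μ y) => ((monotone_cdf μ).reflect_lt (hb.trans_le hy)).le⟩
  have hne : {x | u ≤ cdf μ x}.Nonempty := by
    obtain ⟨b, hb⟩ := ((tendsto_cdf_atTop μ).eventually_const_lt hu.2).exists
    exact ⟨b, hb.le⟩
  refine ⟨fun h => ?_, fun h => csInf_le hbdd h⟩
  have hright : Tendsto (cdf μ) (𝓝[>] x) (𝓝 (cdf μ x)) :=
    ((cdf μ).right_continuous x).tendsto.mono_left (nhdsWithin_mono _ Ioi_subset_Ici_self)
  refine ge_of_tendsto hright (eventually_mem_nhdsWithin.mono fun y hy => ?_)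
  obtain ⟨z, hz, hzy⟩ := exists_lt_of_csInf_lt hne (h.trans_lt hy)
  exact le_trans hz (monotone_cdf μ hzy.le)

theorem lt_quantile_iff (μ : Measure ℝ) {u : ℝ} (hu : u ∈ Ioo (0 : ℝ) 1) (x : ℝ) :
    x < quantile μ u ↔ cdf μ x < u := by
  rw [← not_le, quantile_le_iff μ hu, not_le]

theorem monotoneOn_quantile (μ : Measure ℝ) : MonotoneOn (quantile μ) (Ioo 0 1) :=
  fun _u hu _v hv huv =>
    (quantile_le_iff μ hu _).2 (huv.trans ((quantile_le_iff μ hv _).1 le_rfl))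

theorem ae_continuousAt_quantile (μ : Measure ℝ) :
    ∀ᵐ u ∂volume.restrict (Ioo 0 1), ContinuousAt (quantile μ) u := by
  have hnull := (monotoneOn_quantile μ).countable_not_continuousWithinAt.ae_notMem
    (volume.restrict (Ioo 0 1))
  filter_upwards [hnull, ae_restrict_mem measurableSet_Ioo] with u hu hu01
  exact (not_not.1 fun h => hu ⟨hu01, h⟩).continuousAt (Ioo_mem_nhds hu01.1 hu01.2)

theorem hasLaw_quantile (μ : Measure ℝ) [IsProbabilityMeasure μ] :
    HasLaw (quantile μ) μ (volume.restrict (Ioo 0 1)) := by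
  have hm : AEMeasurable (quantile μ) (volume.restrict (Ioo 0 1)) :=
    aemeasurable_restrict_of_monotoneOn measurableSet_Ioo (monotoneOn_quantile μ)
  refine ⟨hm, Measure.ext_of_Iic _ _ fun x => ?_⟩
  calc (volume.restrict (Ioo 0 1)).map (quantile μ) (Iic x)
      = volume.restrict (Ioo 0 1) (Iic (cdf μ x)) := by
        rw [Measure.map_apply_of_aemeasurable hm measurableSet_Iic]
        exact measure_congr <| (ae_restrict_mem measurableSet_Ioo).mono fun u hu =>
          propext (quantile_le_iff μ hu x)
    _ = ENNReal.ofReal (cdf μ x) := by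
        rw [restrict_Ioo_eq_restrict_Ioc, Measure.restrict_apply measurableSet_Iic, inter_comm,
          Ioc_inter_Iic, Real.volume_Ioc, inf_of_le_right (cdf_le_one μ x), sub_zero]
    _ = μ (Iic x) := ofReal_cdf μ x

theorem exists_measure_singleton_eq_zero_mem_Ioo (μ : Measure ℝ) [SFinite μ] {a b : ℝ}
    (hab : a < b) : ∃ x ∈ Ioo a b, μ {x} = 0 := by
  have hcount : {x : ℝ | 0 < μ {x}}.Countable := by
    simpa using! Measure.countable_meas_level_set_pos (μ := μ) (measurable_id (α := ℝ))
  obtain ⟨x, hx, hxab⟩ := (hcount.dense_compl ℝ).exists_between hab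
  exact ⟨x, hxab, le_zero_iff.1 (not_lt.1 hx)⟩

variable {ι : Type*} {l : Filter ι} {μs : ι → ProbabilityMeasure ℝ} {μ : ProbabilityMeasure ℝ}

theorem tendsto_cdf_of_tendsto (h : Tendsto μs l (𝓝 μ)) {x : ℝ} (hx : (μ : Measure ℝ) {x} = 0) :
    Tendsto (fun i => cdf (μs i : Measure ℝ) x) l (𝓝 (cdf (μ : Measure ℝ) x)) := by
  simp only [cdf_eq_real, measureReal_def]
  refine (ENNReal.tendsto_toReal (measure_ne_top _ _)).comp ?_
  exact ProbabilityMeasure.tendsto_measure_of_null_frontier_of_tendsto' h (by simpa using hx)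

theorem tendsto_quantile_of_tendsto (h : Tendsto μs l (𝓝 μ)) {u : ℝ} (hu : u ∈ Ioo (0 : ℝ) 1)
    (hcont : ContinuousAt (quantile μ) u) :
    Tendsto (fun i => quantile (μs i : Measure ℝ) u) l (𝓝 (quantile (μ : Measure ℝ) u)) := by
  refine tendsto_order.2 ⟨fun a ha => ?_, fun b hb => ?_⟩
  · obtain ⟨x, hx, hx0⟩ := exists_measure_singleton_eq_zero_mem_Ioo (μ : Measure ℝ) ha
    have hlt : cdf (μ : Measure ℝ) x < u := (lt_quantile_iff _ hu _).1 hx.2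
    filter_upwards [(tendsto_cdf_of_tendsto h hx0).eventually_lt_const hlt] with i hi
    exact hx.1.trans ((lt_quantile_iff _ hu _).2 hi)
  · obtain ⟨v, ⟨hvb, hv01⟩, huv⟩ := ((((hcont.eventually_lt_const hb).and
      (Ioo_mem_nhds hu.1 hu.2)).filter_mono nhdsWithin_le_nhds).and
      (eventually_mem_nhdsWithin (a := u) (s := Ioi u))).exists
    obtain ⟨x, hx, hx0⟩ := exists_measure_singleton_eq_zero_mem_Ioo (μ : Measure ℝ) hvb
    have hlt : u < cdf (μ : Measure ℝ) x := huv.trans_le ((quantile_le_iff _ hv01 _).1 hx.1.le)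
    filter_upwards [(tendsto_cdf_of_tendsto h hx0).eventually_const_lt hlt] with i hi
    exact ((quantile_le_iff _ hu _).2 hi.le).trans_lt hx.2

theorem ae_tendsto_quantile_of_tendsto (h : Tendsto μs l (𝓝 μ)) :
    ∀ᵐ u ∂volume.restrict (Ioo 0 1),
      Tendsto (fun i => quantile (μs i : Measure ℝ) u) l (𝓝 (quantile (μ : Measure ℝ) u)) := by
  filter_upwards [ae_restrict_mem measurableSet_Ioo, ae_continuousAt_quantile μ] with u hu hcont
  exact tendsto_quantile_of_tendsto h hu hcont

end Quantile

section ConvexAntitone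

variable {F : Type*} [AddCommGroup F] [Module ℝ F] {f : F → ℝ}

theorem abs_sub_le_div_of_convexOn (hf : ConvexOn ℝ univ f) {y z : F} {t C : ℝ} (ht : 1 ≤ t)
    (hadd : f (y + t • z) ≤ C) (hsub : f (y - t • z) ≤ C) :
    |f (y + z) - f y| ≤ (C - f y) / t := by
  have ht0 : 0 < t := one_pos.trans_le ht
  have hupper : f (y + z) ≤ t⁻¹ * f (y + t • z) + (1 - t⁻¹) * f y := by
    have hcomb : t⁻¹ • (y + t • z) + (1 - t⁻¹) • y = y + z := by
      rw [smul_add, smul_smul, inv_mul_cancel₀ ht0.ne', one_smul]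
      module
    simpa only [hcomb, smul_eq_mul] using hf.2 (mem_univ (y + t • z)) (mem_univ y)
      (inv_nonneg.2 ht0.le) (sub_nonneg.2 (inv_le_one_of_one_le₀ ht)) (by ring)
  have hlower : f y ≤ (1 + t)⁻¹ * f (y - t • z) + ((1 + t)⁻¹ * t) * f (y + z) := by
    have hcomb : (1 + t)⁻¹ • (y - t • z) + ((1 + t)⁻¹ * t) • (y + z) = y := by
      calc (1 + t)⁻¹ • (y - t • z) + ((1 + t)⁻¹ * t) • (y + z)
          = ((1 + t)⁻¹ * (1 + t)) • y := by module
        _ = y := by rw [inv_mul_cancel₀ (by positivity), one_smul]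
    have hsum : (1 + t)⁻¹ + (1 + t)⁻¹ * t = 1 := by field_simp
    simpa only [hcomb, smul_eq_mul] using hf.2 (mem_univ (y - t • z)) (mem_univ (y + z))
      (by positivity) (by positivity) hsum
  rw [abs_le, le_div_iff₀ ht0, neg_le, le_div_iff₀ ht0]
  field_simp at hupper hlower
  constructor <;> linarith

theorem tendsto_of_convexOn_of_antitone [PartialOrder F] [IsOrderedAddMonoid F]
    (hf : ConvexOn ℝ univ f) (hanti : Antitone f) {ι : Type*} {l : Filter ι} {x : ι → F} {y w : F}
    {t : ι → ℝ} (ht : Tendsto t l atTop) (hw : ∀ i, t i • (x i - y) ∈ Icc (-w) w) :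
    Tendsto (fun i => f (x i)) l (𝓝 (f y)) := by
  have hbound : ∀ᶠ i in l, |f (x i) - f y| ≤ (f (y - w) - f y) / t i := by
    filter_upwards [ht.eventually_ge_atTop 1] with i hi
    have hadd : f (y + t i • (x i - y)) ≤ f (y - w) :=
      hanti (by rw [sub_eq_add_neg]; exact add_le_add_right (hw i).1 y)
    have hsub : f (y - t i • (x i - y)) ≤ f (y - w) := hanti (sub_le_sub_left (hw i).2 y)
    simpa only [add_sub_cancel] using abs_sub_le_div_of_convexOn hf hi hadd hsub
  exact tendsto_iff_norm_sub_tendsto_zero.2 <|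
    squeeze_zero' (.of_forall fun i => abs_nonneg _) hbound (ht.const_div_atTop _)

end ConvexAntitone

section OrliczHeart

variable {Ω : Type*} [MeasurableSpace Ω] {P : Measure Ω} {Ψ : YoungFunction}

instance {γ : Type*} [TopologicalSpace γ] [AddCommMonoid γ] [ContinuousAdd γ] [PartialOrder γ]
    [IsOrderedAddMonoid γ] : IsOrderedAddMonoid (Ω →ₘ[P] γ) where
  add_le_add_left X Y hXY Z := by
    rw [← AEEqFun.coeFn_le] at hXY ⊢
    filter_upwards [hXY, AEEqFun.coeFn_add X Z, AEEqFun.coeFn_add Y Z] with ω hω hX hY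
    rw [hX, hY, Pi.add_apply, Pi.add_apply]
    exact add_le_add_left hω _

theorem continuous_orliczGauge (Ψ : YoungFunction) (k : ℕ+) : Continuous (orliczGauge Ψ k) :=
  Ψ.continuous'.comp (continuous_const.mul continuous_nnnorm)

theorem measurable_orliczGauge (Ψ : YoungFunction) (k : ℕ+) :
    Measurable fun x : ℝ => (orliczGauge Ψ k x : ℝ≥0∞) :=
  (continuous_orliczGauge Ψ k).measurable.coe_nnreal_ennreal

theorem orliczGauge_zero (Ψ : YoungFunction) (k : ℕ+) : orliczGauge Ψ k 0 = 0 := by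
  rw [orliczGauge, nnnorm_zero, mul_zero, Ψ.map_zero']

theorem orliczGauge_mono_left (Ψ : YoungFunction) {k m : ℕ+} (h : k ≤ m) (x : ℝ) :
    orliczGauge Ψ k x ≤ orliczGauge Ψ m x :=
  Ψ.monotone' (mul_le_mul_left (Nat.cast_le.2 (PNat.coe_le_coe _ _ |>.2 h)) _)

theorem orliczGauge_natCast_mul (Ψ : YoungFunction) (k m : ℕ+) (x : ℝ) :
    orliczGauge Ψ k ((m : ℕ) * x) = orliczGauge Ψ (k * m) x := by
  simp only [orliczGauge, nnnorm_mul, Real.nnnorm_natCast, PNat.mul_coe, Nat.cast_mul, mul_assoc]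

theorem orliczGauge_sub_le (Ψ : YoungFunction) (k : ℕ+) (x y : ℝ) :
    orliczGauge Ψ k (x - y) ≤ orliczGauge Ψ (2 * k) x + orliczGauge Ψ (2 * k) y := by
  calc orliczGauge Ψ k (x - y)
      ≤ Ψ (((k : ℕ) : ℝ≥0) * ‖x‖₊ + ((k : ℕ) : ℝ≥0) * ‖y‖₊) :=
        Ψ.monotone' (by rw [← mul_add]; gcongr; exact nnnorm_sub_le _ _)
    _ ≤ _ := by simpa [orliczGauge, mul_assoc] using Ψ.add_le _ _

theorem YoungFunction.bddAbove_range_of_tsum_ne_top {ι : Type*} {a : ι → ℝ≥0}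
    (h : ∑' i, (Ψ (a i) : ℝ≥0∞) ≠ ∞) : BddAbove (range a) := by
  obtain ⟨K, hK⟩ := (Ψ.tendsto'.eventually_gt_atTop (∑' i, (Ψ (a i) : ℝ≥0∞)).toNNReal).exists
  refine ⟨K, forall_mem_range.2 fun i => (Ψ.monotone'.reflect_lt (hK.trans_le' ?_)).le⟩
  exact ENNReal.toNNReal_mono h (ENNReal.le_tsum i)

theorem orliczGauge_iSup_le_tsum {ι : Type*} [Nonempty ι] (k : ℕ+) {a : ι → ℝ≥0}
    (ha : BddAbove (range a)) :
    (orliczGauge Ψ k (⨆ i, a i : ℝ≥0) : ℝ≥0∞) ≤ ∑' i, (orliczGauge Ψ k (a i) : ℝ≥0∞) := by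
  have hmono : Monotone fun x : ℝ≥0 => (orliczGauge Ψ k x : ℝ≥0∞) := fun x y hxy =>
    ENNReal.coe_le_coe.2 (Ψ.monotone' (mul_le_mul_right (by simpa using hxy) _))
  have hcont : Continuous fun x : ℝ≥0 => (orliczGauge Ψ k x : ℝ≥0∞) :=
    ENNReal.continuous_coe.comp ((continuous_orliczGauge Ψ k).comp NNReal.continuous_coe)
  exact (hmono.map_ciSup_of_continuousAt hcont.continuousAt ha).trans_le
    (iSup_le fun i => ENNReal.le_tsum i)

theorem exists_orliczHeart_ae_eq {f : Ω → ℝ} (hf : AEMeasurable f P)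
    (h : ∀ k, ∫⁻ ω, (orliczGauge Ψ k (f ω) : ℝ≥0∞) ∂P < ∞) :
    ∃ X : orliczHeart P Ψ, (X : Ω →ₘ[P] ℝ) =ᵐ[P] f := by
  have hmk := AEEqFun.coeFn_mk f hf.aestronglyMeasurable
  refine ⟨⟨AEEqFun.mk f hf.aestronglyMeasurable, fun c _ => ?_⟩, hmk⟩
  obtain ⟨n, hn⟩ := exists_nat_ge c
  refine (lintegral_mono_ae ?_).trans_lt (h n.succPNat)
  filter_upwards [hmk] with ω hω
  have hle : c ≤ ((n.succPNat : ℕ) : ℝ≥0) := hn.trans (by simp)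
  rw [hω]
  exact ENNReal.coe_le_coe.2 (Ψ.monotone' (mul_le_mul_left hle _))

/-- The modular `E[Ψ(k|X|)]` of a random variable `X`. The Orlicz heart consists of the random
variables all of whose modulars are finite, and its topology is that of convergence to zero of all
modulars. -/
noncomputable def modular (Ψ : YoungFunction) (k : ℕ+) (X : Ω →ₘ[P] ℝ) : ℝ≥0∞ :=
  ∫⁻ ω, (orliczGauge Ψ k (X ω) : ℝ≥0∞) ∂P

theorem modular_ne_top (X : orliczHeart P Ψ) (k : ℕ+) : modular Ψ k (X : Ω →ₘ[P] ℝ) ≠ ∞ :=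
  (X.2 _ (Nat.cast_pos.2 k.pos)).ne

theorem modular_mono_left {k m : ℕ+} (h : k ≤ m) (X : Ω →ₘ[P] ℝ) :
    modular Ψ k X ≤ modular Ψ m X :=
  lintegral_mono fun _ => ENNReal.coe_le_coe.2 (orliczGauge_mono_left Ψ h _)

theorem modular_natCast_smul (k m : ℕ+) (X : Ω →ₘ[P] ℝ) :
    modular Ψ k (((m : ℕ) : ℝ) • X) = modular Ψ (k * m) X :=
  lintegral_congr_ae <| (AEEqFun.coeFn_smul ((m : ℕ) : ℝ) X).mono fun ω hω => by
    simp only [hω, Pi.smul_apply, smul_eq_mul, orliczGauge_natCast_mul]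

theorem exists_orliczHeart_forall_mem_Icc {ι : Type*} [Nonempty ι] [Countable ι]
    {Y : ι → Ω →ₘ[P] ℝ} (hY : ∀ k, ∑' i, modular Ψ k (Y i) ≠ ∞) :
    ∃ W : orliczHeart P Ψ, ∀ i, Y i ∈ Icc (-(W : Ω →ₘ[P] ℝ)) W := by
  have hm (k : ℕ+) (i : ι) : Measurable fun ω => (orliczGauge Ψ k (Y i ω) : ℝ≥0∞) :=
    (measurable_orliczGauge Ψ k).comp (Y i).measurable
  have hint (k : ℕ+) : ∫⁻ ω, ∑' i, (orliczGauge Ψ k (Y i ω) : ℝ≥0∞) ∂P ≠ ∞ := by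
    rw [lintegral_tsum fun i => (hm k i).aemeasurable]
    exact hY k
  have hbdd : ∀ᵐ ω ∂P, BddAbove (range fun i => ‖Y i ω‖₊) := by
    filter_upwards [ae_lt_top (Measurable.tsum fun i => hm 1 i) (hint 1)] with ω hω
    exact Ψ.bddAbove_range_of_tsum_ne_top (by simpa [orliczGauge] using hω.ne)
  have hsup : Measurable fun ω => ((⨆ i, ‖Y i ω‖₊ : ℝ≥0) : ℝ) :=
    (Measurable.iSup fun i => (Y i).measurable.nnnorm).coe_nnreal_real
  obtain ⟨W, hW⟩ := exists_orliczHeart_ae_eq (Ψ := Ψ) hsup.aemeasurable fun k =>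
    (lintegral_mono_ae (hbdd.mono fun ω hω => by
      simpa [orliczGauge] using orliczGauge_iSup_le_tsum (Ψ := Ψ) k hω)).trans_lt (hint k).lt_top
  have habs (i : ι) : ∀ᵐ ω ∂P, |Y i ω| ≤ (W : Ω →ₘ[P] ℝ) ω := by
    filter_upwards [hW, hbdd] with ω hω hb
    rw [hω]
    exact_mod_cast le_ciSup hb i
  refine ⟨W, fun i => ⟨AEEqFun.coeFn_le.1 ?_, AEEqFun.coeFn_le.1 ?_⟩⟩
  · filter_upwards [habs i, AEEqFun.coeFn_neg (W : Ω →ₘ[P] ℝ)] with ω hω hneg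
    rw [hneg]
    exact neg_le_of_abs_le hω
  · filter_upwards [habs i] with ω hω
    exact le_of_abs_le hω

theorem exists_tsum_modular_smul_ne_top {Z : ℕ → orliczHeart P Ψ}
    (hZ : ∀ k, Tendsto (fun n => modular Ψ k (Z n : Ω →ₘ[P] ℝ)) atTop (𝓝 0)) :
    ∃ φ : ℕ → ℕ, ∀ k,
      ∑' j : ℕ, modular Ψ k (((j.succPNat : ℕ) : ℝ) • (Z (φ j) : Ω →ₘ[P] ℝ)) ≠ ∞ := by
  -- Diagonal choice: for `j ≥ k` the `j`-th term of the `k`-th series is at most `2⁻ʲ`.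
  have hsmall (j : ℕ) : ∃ n,
      modular Ψ (j.succPNat * j.succPNat) (Z n : Ω →ₘ[P] ℝ) < (2 : ℝ≥0∞)⁻¹ ^ j :=
    ((hZ _).eventually_lt_const (ENNReal.pow_pos (by simp) j)).exists
  choose φ hφ using hsmall
  refine ⟨φ, fun k => ?_⟩
  simp only [modular_natCast_smul]
  rw [← ENNReal.summable.sum_add_tsum_nat_add' (k := (k : ℕ))]
  refine ENNReal.add_ne_top.2 ⟨ENNReal.sum_ne_top.2 fun j _ => modular_ne_top _ _, ?_⟩
  have htail (j : ℕ) : modular Ψ (k * (j + k).succPNat) (Z (φ (j + k)) : Ω →ₘ[P] ℝ) ≤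
      (2 : ℝ≥0∞)⁻¹ ^ j := by
    have hk : k ≤ (j + k).succPNat := PNat.coe_le_coe _ _ |>.1 (by simp; lia)
    calc modular Ψ (k * (j + k).succPNat) (Z (φ (j + k)) : Ω →ₘ[P] ℝ)
        ≤ (2 : ℝ≥0∞)⁻¹ ^ (j + k) :=
          (modular_mono_left (mul_le_mul_left hk _) _).trans (hφ _).le
      _ ≤ (2 : ℝ≥0∞)⁻¹ ^ j := pow_le_pow_of_le_one zero_le (by simp) (Nat.le_add_right _ _)
  refine ne_top_of_le_ne_top ?_ (ENNReal.tsum_le_tsum htail)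
  rw [ENNReal.tsum_geometric, ENNReal.one_sub_inv_two, inv_inv]
  exact ENNReal.ofNat_ne_top

theorem tendsto_of_tendsto_modular_sub {ρ : orliczHeart P Ψ → ℝ} (hanti : Antitone ρ)
    (hconv : ConvexOn ℝ univ ρ) {X : ℕ → orliczHeart P Ψ} {Y : orliczHeart P Ψ}
    (h : ∀ k, Tendsto (fun n => modular Ψ k (X n - Y : Ω →ₘ[P] ℝ)) atTop (𝓝 0)) :
    Tendsto (fun n => ρ (X n)) atTop (𝓝 (ρ Y)) := by
  refine tendsto_of_subseq_tendsto fun ns hns => ?_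
  obtain ⟨φ, hφ⟩ := exists_tsum_modular_smul_ne_top (Z := fun n => X (ns n) - Y)
    fun k => (h k).comp hns
  obtain ⟨W, hW⟩ := exists_orliczHeart_forall_mem_Icc hφ
  have hscale : Tendsto (fun j : ℕ => ((j.succPNat : ℕ) : ℝ)) atTop atTop :=
    tendsto_natCast_atTop_atTop.comp (tendsto_add_atTop_nat 1)
  exact ⟨φ, tendsto_of_convexOn_of_antitone hconv hanti hscale hW⟩

theorem IsLawInvariantConvexRiskMeasure.antitone [IsProbabilityMeasure P]
    {ρ : orliczHeart P Ψ → ℝ} (hρ : IsLawInvariantConvexRiskMeasure P Ψ ρ) : Antitone ρ :=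
  fun X Y hXY => hρ.monotonicity X Y (AEEqFun.coeFn_le.2 hXY)

theorem IsLawInvariantConvexRiskMeasure.convexOn [IsProbabilityMeasure P]
    {ρ : orliczHeart P Ψ → ℝ} (hρ : IsLawInvariantConvexRiskMeasure P Ψ ρ) :
    ConvexOn ℝ univ ρ := by
  refine ⟨convex_univ, fun X _ Y _ a b ha hb hab => ?_⟩
  obtain rfl : b = 1 - a := eq_sub_of_add_eq' hab
  exact hρ.convexity X Y a ha (sub_nonneg.1 hb)

end OrliczHeart

section GeneralizedDominatedConvergence

variable {Ω ι : Type*} [MeasurableSpace Ω] {P : Measure Ω} {l : Filter ι} [l.IsCountablyGenerated]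
  {F G : ι → Ω → ℝ≥0∞} {g : Ω → ℝ≥0∞}

theorem tendsto_lintegral_sub_of_tendsto_lintegral (hG : ∀ i, AEMeasurable (G i) P)
    (hg : AEMeasurable g P) (hGg : ∀ᵐ ω ∂P, Tendsto (fun i => G i ω) l (𝓝 (g ω)))
    (hgi : ∫⁻ ω, g ω ∂P ≠ ∞)
    (hGi : Tendsto (fun i => ∫⁻ ω, G i ω ∂P) l (𝓝 (∫⁻ ω, g ω ∂P))) :
    Tendsto (fun i => ∫⁻ ω, (G i ω - g ω) ∂P) l (𝓝 0) := by
  have hmin : Tendsto (fun i => ∫⁻ ω, min (G i ω) (g ω) ∂P) l (𝓝 (∫⁻ ω, g ω ∂P)) :=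
    tendsto_lintegral_filter_of_dominated_convergence' g (.of_forall fun i => (hG i).min hg)
      (.of_forall fun i => ae_of_all _ fun ω => min_le_right _ _) hgi
      (hGg.mono fun ω hω => by
        simpa only [min_self] using hω.min (tendsto_const_nhds (x := g ω)))
  have hsub (i : ι) : ∫⁻ ω, (G i ω - g ω) ∂P = ∫⁻ ω, G i ω ∂P - ∫⁻ ω, min (G i ω) (g ω) ∂P := by
    rw [← lintegral_sub' ((hG i).min hg)
      (ne_top_of_le_ne_top hgi (lintegral_mono fun ω => min_le_right _ _))
      (ae_of_all _ fun ω => min_le_left _ _)]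
    simp only [tsub_min]
  simpa only [hsub, tsub_self] using ENNReal.Tendsto.sub hGi hmin (.inl hgi)

theorem tendsto_lintegral_zero_of_le_of_tendsto_lintegral (hF : ∀ i, AEMeasurable (F i) P)
    (hG : ∀ i, AEMeasurable (G i) P) (hg : AEMeasurable g P) (hFG : ∀ i, F i ≤ᵐ[P] G i)
    (hF0 : ∀ᵐ ω ∂P, Tendsto (fun i => F i ω) l (𝓝 0))
    (hGg : ∀ᵐ ω ∂P, Tendsto (fun i => G i ω) l (𝓝 (g ω))) (hgi : ∫⁻ ω, g ω ∂P ≠ ∞)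
    (hGi : Tendsto (fun i => ∫⁻ ω, G i ω ∂P) l (𝓝 (∫⁻ ω, g ω ∂P))) :
    Tendsto (fun i => ∫⁻ ω, F i ω ∂P) l (𝓝 0) := by
  have hmin : Tendsto (fun i => ∫⁻ ω, min (F i ω) (g ω) ∂P) l (𝓝 0) := by
    simpa only [lintegral_zero] using
      tendsto_lintegral_filter_of_dominated_convergence' (f := fun _ => 0) g
        (.of_forall fun i => (hF i).min hg)
        (.of_forall fun i => ae_of_all _ fun ω => min_le_right _ _) hgi
        (hF0.mono fun ω hω => by
          simpa only [zero_min] using hω.min (tendsto_const_nhds (x := g ω)))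
  have hexcess := tendsto_lintegral_sub_of_tendsto_lintegral hG hg hGg hgi hGi
  refine tendsto_of_tendsto_of_tendsto_of_le_of_le tendsto_const_nhds
    (by simpa only [add_zero] using hmin.add hexcess) (fun i => zero_le) fun i => ?_
  calc ∫⁻ ω, F i ω ∂P ≤ ∫⁻ ω, (min (F i ω) (g ω) + (G i ω - g ω)) ∂P := by
        refine lintegral_mono_ae ((hFG i).mono fun ω hω => ?_)
        rcases le_total (F i ω) (g ω) with h | h
        · exact (min_eq_left h).ge.trans le_self_add
        · rw [min_eq_right h, add_tsub_cancel_of_le (h.trans hω)]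
          exact hω
    _ = _ := lintegral_add_left' ((hF i).min hg) _

end GeneralizedDominatedConvergence

section ModularConvergence

variable {Ω : Type*} [MeasurableSpace Ω] {P : Measure Ω} {Ψ : YoungFunction}

theorem tendsto_modular_sub_of_ae_tendsto {X : ℕ → orliczHeart P Ψ} {Y : orliczHeart P Ψ}
    (hae : ∀ᵐ ω ∂P, Tendsto (fun n => (X n : Ω →ₘ[P] ℝ) ω) atTop (𝓝 ((Y : Ω →ₘ[P] ℝ) ω)))
    (hmod : ∀ k, Tendsto (fun n => modular Ψ k (X n : Ω →ₘ[P] ℝ)) atTop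
      (𝓝 (modular Ψ k (Y : Ω →ₘ[P] ℝ)))) (k : ℕ+) :
    Tendsto (fun n => modular Ψ k (X n - Y : Ω →ₘ[P] ℝ)) atTop (𝓝 0) := by
  have hm (k : ℕ+) (Z : Ω →ₘ[P] ℝ) : Measurable fun ω => (orliczGauge Ψ k (Z ω) : ℝ≥0∞) :=
    (measurable_orliczGauge Ψ k).comp Z.measurable
  have hlim {k : ℕ+} {u : ℕ → ℝ} {x : ℝ} (hu : Tendsto u atTop (𝓝 x)) :
      Tendsto (fun n => (orliczGauge Ψ k (u n) : ℝ≥0∞)) atTop (𝓝 (orliczGauge Ψ k x)) :=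
    ENNReal.tendsto_coe.2 (((continuous_orliczGauge Ψ k).tendsto x).comp hu)
  have hcoe : ∀ᵐ ω ∂P, ∀ n, ((X n - Y : Ω →ₘ[P] ℝ)) ω =
      (X n : Ω →ₘ[P] ℝ) ω - (Y : Ω →ₘ[P] ℝ) ω := ae_all_iff.2 fun n => AEEqFun.coeFn_sub _ _
  refine tendsto_lintegral_zero_of_le_of_tendsto_lintegral
    (G := fun n ω => (orliczGauge Ψ (2 * k) ((X n : Ω →ₘ[P] ℝ) ω) : ℝ≥0∞) +
      orliczGauge Ψ (2 * k) ((Y : Ω →ₘ[P] ℝ) ω))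
    (g := fun ω => (orliczGauge Ψ (2 * k) ((Y : Ω →ₘ[P] ℝ) ω) : ℝ≥0∞) +
      orliczGauge Ψ (2 * k) ((Y : Ω →ₘ[P] ℝ) ω))
    (fun n => (hm _ _).aemeasurable) (fun n => ((hm _ _).add (hm _ _)).aemeasurable)
    ((hm _ _).add (hm _ _)).aemeasurable (fun n => ?_) ?_ ?_ ?_ ?_
  · filter_upwards [hcoe] with ω hω
    rw [hω n]
    exact_mod_cast orliczGauge_sub_le Ψ k _ _
  · filter_upwards [hae, hcoe] with ω hω hsub
    simpa only [hsub, sub_self, orliczGauge_zero, ENNReal.coe_zero] using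
      hlim (hω.sub_const ((Y : Ω →ₘ[P] ℝ) ω))
  · filter_upwards [hae] with ω hω
    exact (hlim hω).add tendsto_const_nhds
  · rw [lintegral_add_left (hm _ _)]
    exact ENNReal.add_ne_top.2 ⟨modular_ne_top Y (2 * k), modular_ne_top Y (2 * k)⟩
  · simp only [lintegral_add_right _ (hm _ (Y : Ω →ₘ[P] ℝ))]
    exact (hmod (2 * k)).add tendsto_const_nhds

end ModularConvergence

section GaugeTopology

variable {E ι : Type*} [TopologicalSpace E]

theorem gauge_mem_gaugeBounded {φ : E → ℝ≥0} (hφ : Continuous φ) :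
    (fun x => (φ x : ℝ)) ∈ gaugeBounded φ := by
  refine ⟨NNReal.continuous_coe.comp hφ, 1, forall_mem_range.2 fun x => ?_⟩
  rw [abs_of_nonneg (by positivity), div_le_one (by positivity)]
  exact le_add_of_nonneg_left zero_le_one

theorem boundedContinuousFunction_mem_gaugeBounded (φ : E → ℝ≥0)
    (f : BoundedContinuousFunction E ℝ) : ⇑f ∈ gaugeBounded φ := by
  refine ⟨f.continuous, ‖f‖, forall_mem_range.2 fun x => ?_⟩
  rw [abs_div, abs_of_nonneg (by positivity : (0 : ℝ) ≤ 1 + φ x)]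
  exact (div_le_self (abs_nonneg _) (le_add_of_nonneg_right (φ x).2)).trans (f.norm_coe_le_norm x)

variable [MeasurableSpace E] {ψ : ι → E → ℝ≥0}

theorem continuous_integral_gaugeMeasure {k : ι} {f : E → ℝ} (hf : f ∈ gaugeBounded (ψ k)) :
    Continuous fun μ : GaugeMeasure ψ => ∫ x, f x ∂(μ.toProb : Measure E) := by
  rw [continuous_iff_le_induced]
  exact iInf_le_of_le k (iInf_le _ (⟨f, hf⟩ : gaugeBounded (ψ k)))

theorem continuous_toProb [OpensMeasurableSpace E] [Nonempty ι] :
    Continuous (GaugeMeasure.toProb : GaugeMeasure ψ → ProbabilityMeasure E) := by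
  refine continuous_iff_continuousAt.2 fun μ => ?_
  refine ProbabilityMeasure.tendsto_iff_forall_integral_tendsto.2 fun f => ?_
  exact (continuous_integral_gaugeMeasure
    (boundedContinuousFunction_mem_gaugeBounded (ψ (Classical.arbitrary ι)) f)).tendsto μ

theorem continuous_lintegral_gauge [OpensMeasurableSpace E] {k : ι} (hψ : Continuous (ψ k)) :
    Continuous fun μ : GaugeMeasure ψ => ∫⁻ x, (ψ k x : ℝ≥0∞) ∂(μ.toProb : Measure E) := by
  have hreal (μ : GaugeMeasure ψ) : ∫⁻ x, (ψ k x : ℝ≥0∞) ∂(μ.toProb : Measure E) =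
      ENNReal.ofReal (∫ x, (ψ k x : ℝ) ∂(μ.toProb : Measure E)) :=
    lintegral_coe_eq_integral _
      ⟨(NNReal.continuous_coe.comp hψ).measurable.aestronglyMeasurable, by
        simpa only [hasFiniteIntegral_iff_enorm, NNReal.enorm_eq] using μ.lintegral_lt_top k⟩
  simp only [hreal]
  exact ENNReal.continuous_ofReal.comp
    (continuous_integral_gaugeMeasure (gauge_mem_gaugeBounded hψ))

theorem continuous_of_seqContinuous [TopologicalSpace.PseudoMetrizableSpace E]
    [TopologicalSpace.SeparableSpace E] [OpensMeasurableSpace E] [Nonempty ι] [Countable ι]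
    (hψ : ∀ k, Continuous (ψ k)) {X : Type*} [TopologicalSpace X] {R : GaugeMeasure ψ → X}
    (h : ∀ (μs : ℕ → GaugeMeasure ψ) (μ : GaugeMeasure ψ),
      Tendsto (fun n => (μs n).toProb) atTop (𝓝 μ.toProb) →
      (∀ k, Tendsto (fun n => ∫⁻ x, (ψ k x : ℝ≥0∞) ∂((μs n).toProb : Measure E)) atTop
        (𝓝 (∫⁻ x, (ψ k x : ℝ≥0∞) ∂(μ.toProb : Measure E)))) →
      Tendsto (fun n => R (μs n)) atTop (𝓝 (R μ))) : Continuous R := by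
  -- Sequences suffice because `J` takes values in a first-countable space; in this way the gauge
  -- topology itself need not be shown to be first-countable.
  let J (μ : GaugeMeasure ψ) : ProbabilityMeasure E × (ι → ℝ≥0∞) :=
    (μ.toProb, fun k => ∫⁻ x, (ψ k x : ℝ≥0∞) ∂(μ.toProb : Measure E))
  have hJ : Continuous J :=
    continuous_toProb.prodMk (continuous_pi fun k => continuous_lintegral_gauge (hψ k))
  refine continuous_iff_continuousAt.2 fun μ => ?_
  have hcomap : Tendsto R (comap J (𝓝 (J μ))) (𝓝 (R μ)) := by
    refine tendsto_of_seq_tendsto fun μs hμs => ?_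
    have hlim : Tendsto (J ∘ μs) atTop (𝓝 (J μ)) := tendsto_comap_iff.1 hμs
    rw [nhds_prod_eq] at hlim
    exact h μs μ hlim.fst (tendsto_pi_nhds.1 hlim.snd)
  exact hcomap.mono_left (hJ.tendsto μ).le_comap

end GaugeTopology

section Representation

variable {Ω : Type*} [MeasurableSpace Ω] {P : Measure Ω} [IsProbabilityMeasure P]
  {Ψ : YoungFunction} {ρ : orliczHeart P Ψ → ℝ} {R : GaugeMeasure (orliczGauge Ψ) → ℝ}

theorem exists_ae_eq_heartLaw_eq_of_hasLaw {f : Ω → ℝ} (μ : GaugeMeasure (orliczGauge Ψ))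
    (hf : HasLaw f μ.toProb P) :
    ∃ X : orliczHeart P Ψ, (X : Ω →ₘ[P] ℝ) =ᵐ[P] f ∧ heartLaw P Ψ X = μ := by
  obtain ⟨X, hX⟩ := exists_orliczHeart_ae_eq (Ψ := Ψ) hf.aemeasurable fun k => by
    rw [hf.lintegral_comp (measurable_orliczGauge Ψ k).aemeasurable]
    exact μ.lintegral_lt_top k
  refine ⟨X, hX, ?_⟩
  rcases μ with ⟨μ, hμ⟩
  obtain rfl : law P X = μ := Subtype.ext ((Measure.map_congr hX).trans hf.map_eq)
  rfl

theorem lintegral_orliczGauge_heartLaw (X : orliczHeart P Ψ) (k : ℕ+) :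
    ∫⁻ x, (orliczGauge Ψ k x : ℝ≥0∞) ∂((heartLaw P Ψ X).toProb : Measure ℝ) =
      modular Ψ k (X : Ω →ₘ[P] ℝ) :=
  lintegral_map (measurable_orliczGauge Ψ k) (X : Ω →ₘ[P] ℝ).measurable

theorem Atomless.surjective_heartLaw (hP : Atomless P) (Ψ : YoungFunction) :
    Function.Surjective (heartLaw P Ψ) := fun μ => by
  obtain ⟨U, hU⟩ := hP.exists_hasLaw_uniform
  obtain ⟨X, -, hX⟩ := exists_ae_eq_heartLaw_eq_of_hasLaw μ ((hasLaw_quantile μ.toProb).comp hU)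
  exact ⟨X, hX⟩

theorem existsUnique_isRiskFunctional (hP : Atomless P)
    (hlaw : ∀ X Y : orliczHeart P Ψ, law P X = law P Y → ρ X = ρ Y) :
    ∃! R, IsRiskFunctional P Ψ ρ R := by
  have hsurj := hP.surjective_heartLaw Ψ
  refine ⟨fun μ => ρ (Function.surjInv hsurj μ), fun X => hlaw _ _ ?_, fun R hR => ?_⟩
  · exact congrArg GaugeMeasure.toProb (Function.surjInv_eq hsurj (heartLaw P Ψ X)).symm
  · funext μ
    rw [hR, Function.surjInv_eq hsurj]

theorem IsRiskFunctional.continuous (hR : IsRiskFunctional P Ψ ρ R) (hP : Atomless P)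
    (hanti : Antitone ρ) (hconv : ConvexOn ℝ univ ρ) : Continuous R := by
  obtain ⟨U, hU⟩ := hP.exists_hasLaw_uniform
  choose X hXU hX using fun μ : GaugeMeasure (orliczGauge Ψ) =>
    exists_ae_eq_heartLaw_eq_of_hasLaw μ ((hasLaw_quantile μ.toProb).comp hU)
  have hRX (μ : GaugeMeasure (orliczGauge Ψ)) : R μ = ρ (X μ) := by rw [hR (X μ), hX]
  refine continuous_of_seqContinuous (continuous_orliczGauge Ψ) fun μs μ hweak hgauge => ?_
  have hquantile := ae_of_ae_map hU.aemeasurable (hU.map_eq ▸ ae_tendsto_quantile_of_tendsto hweak)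
  have hae : ∀ᵐ ω ∂P, Tendsto (fun n => (X (μs n) : Ω →ₘ[P] ℝ) ω) atTop
      (𝓝 ((X μ : Ω →ₘ[P] ℝ) ω)) := by
    filter_upwards [hquantile, hXU μ, ae_all_iff.2 fun n => hXU (μs n)] with ω hω hlim hseq
    simpa only [hlim, hseq, Function.comp_apply] using hω
  have hmod (k : ℕ+) : Tendsto (fun n => modular Ψ k (X (μs n) : Ω →ₘ[P] ℝ)) atTop
      (𝓝 (modular Ψ k (X μ : Ω →ₘ[P] ℝ))) := by
    simpa only [← lintegral_orliczGauge_heartLaw, hX] using hgauge k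
  simp only [hRX]
  exact tendsto_of_tendsto_modular_sub hanti hconv (tendsto_modular_sub_of_ae_tendsto hae hmod)

end Representation

end RiskFunctional

/-- The three parts of the conclusion: every element of `M_1^{(ψ_k)}` is the law of an element of
`H^Ψ` (so the two sets of measures coincide); `ρ` has exactly one risk functional on this set; and
the risk functional is continuous for the `(ψ_k)`-weak topology. -/
theorem mainTheorem3 {Ω : Type*} [MeasurableSpace Ω]
    (P : MeasureTheory.Measure Ω) [MeasureTheory.IsProbabilityMeasure P]
    (hP : RiskFunctional.Atomless P) (Ψ : RiskFunctional.YoungFunction)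
    (ρ : RiskFunctional.orliczHeart P Ψ → ℝ)
    (hρ : RiskFunctional.IsLawInvariantConvexRiskMeasure P Ψ ρ) :
    Set.range (RiskFunctional.heartLaw P Ψ) = Set.univ ∧
    (∃! R : RiskFunctional.GaugeMeasure (RiskFunctional.orliczGauge Ψ) → ℝ,
      RiskFunctional.IsRiskFunctional P Ψ ρ R) ∧
    ∀ R : RiskFunctional.GaugeMeasure (RiskFunctional.orliczGauge Ψ) → ℝ,
      RiskFunctional.IsRiskFunctional P Ψ ρ R → Continuous R := by
  exact ⟨Set.range_eq_univ.2 (hP.surjective_heartLaw Ψ),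
    RiskFunctional.existsUnique_isRiskFunctional hP hρ.lawInvariance,
    fun _ hR => hR.continuous hP hρ.antitone hρ.convexOn⟩
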